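/- Let $d,d'\ge 1$, let $(A_{ir})_{1\le i\le d,\,1\le r\le d'}$ and $(b_i)_{1\le i\le d}$ be square integrable complex random variables on a probability space, and let $\pi(i,r)\in\{1,\dots,d\}$ for $1\le i\le d$, $1\le r\le d'$. For a $d$-tuple $(\mu_1,\dots,\mu_d)$ of Borel probability distributions on $\mathbb{C}$ let $T'(\mu_1,\dots,\mu_d)=(T'_1(\mu_1,\dots,\mu_d),\dots,T'_d(\mu_1,\dots,\mu_d))$ with $$T'_i(\mu_1,\dots,\mu_d):=\mathcal{L}\Big(\sum_{r=1}^{d'}A_{ir}Z_{ir}+b_i\Big),\qquad i=1,\dots,d,$$ where $(A_{i1},\dots,A_{id'},b_i),Z_{i1},\dots,Z_{id'}$ are independent and $Z_{ir}$ has distribution $\mu_{\pi(i,r)}$. For $\gamma\in\mathbb{C}$ let $\mathcal{M}_2^{\mathbb{C}}(\gamma)$ be the set of Borel probability distributions on $\mathbb{C}$ with finite second absolute moment and mean $\gamma$. Suppose that $\gamma_1,\dots,\gamma_d\in\mathbb{C}$ satisfy $$\mathbb{E}[b_i]+\sum_{r=1}^{d'}\gamma_{\pi(i,r)}\,\mathbb{E}[A_{ir}]=\gamma_i,\qquad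 i=1,\dots,d,$$ and that $$\max_{1\le i\le d}\ \sum_{r=1}^{d'}\mathbb{E}\big[|A_{ir}|^2\big]<1.$$ Then $T'$ maps $\mathcal{M}_2^{\mathbb{C}}(\gamma_1)\times\cdots\times\mathcal{M}_2^{\mathbb{C}}(\gamma_d)$ into itself, and the restriction of $T'$ to this set has a unique fixed point. -/

import Mathlib

open MeasureTheory ProbabilityTheory

/-- The set of probability distributions on `ℂ` with finite second absolute moment and
mean `γ`. -/
def complexM2 (γ : ℂ) : Set (ProbabilityMeasure ℂ) :=
  {μ | MemLp (fun z : ℂ => z) 2 (μ : Measure ℂ) ∧ ∫ z, z ∂(μ : Measure ℂ) = γ}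

/-- The affine combination `∑ r, A r * Z r + b` on the product space `Ω × ℂ^{d'}`, where the
coefficients are functions on `Ω` and `Z r` is the `r`-th coordinate of the second factor. -/
def affineSum {d' : ℕ} {Ω : Type*} (A : Fin d' → Ω → ℂ) (b : Ω → ℂ)
    (x : Ω × (Fin d' → ℂ)) : ℂ :=
  ∑ r, A r x.1 * x.2 r + b x.1

theorem affineSum_aemeasurable {d' : ℕ} {Ω : Type*} [MeasurableSpace Ω]
    (P : Measure Ω) (κ : Measure (Fin d' → ℂ)) [SFinite κ]
    (A : Fin d' → Ω → ℂ) (b : Ω → ℂ)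
    (hA : ∀ r, AEMeasurable (A r) P) (hb : AEMeasurable b P) :
    AEMeasurable (affineSum A b) (P.prod κ) := by
  unfold affineSum
  refine AEMeasurable.add (Finset.aemeasurable_fun_sum _ fun r _ => ?_) hb.comp_fst
  exact (hA r).comp_fst.mul ((measurable_pi_apply r).comp measurable_snd).aemeasurable

/-- The map `T'` on `d`-tuples of probability distributions on `ℂ`: its `i`-th component is the
law of `∑ r, A i r * Z i r + b i`, where `(A i 1, …, A i d', b i), Z i 1, …, Z i d'` are
independent and `Z i r` has law `μ (π i r)`. Independence is realised on the product of the
underlying probability space with the product of the laws `μ (π i r)`. -/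
noncomputable def fixedPointMap {d d' : ℕ} {Ω : Type*} [MeasurableSpace Ω]
    (P : Measure Ω) [IsProbabilityMeasure P]
    (A : Fin d → Fin d' → Ω → ℂ) (b : Fin d → Ω → ℂ)
    (hA : ∀ i r, AEMeasurable (A i r) P) (hb : ∀ i, AEMeasurable (b i) P)
    (π : Fin d → Fin d' → Fin d)
    (μ : Fin d → ProbabilityMeasure ℂ) : Fin d → ProbabilityMeasure ℂ :=
  fun i =>
    ⟨(P.prod (Measure.pi fun r => (μ (π i r) : Measure ℂ))).map (affineSum (A i) (b i)),
      Measure.isProbabilityMeasure_map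
        (affineSum_aemeasurable P _ (A i) (b i) (hA i) (hb i))⟩

open Filter Topology RealInnerProductSpace ComplexConjugate

/-! The map is a contraction for the distance `sup_t ‖φ t - ψ t‖ / ‖t‖ ^ 2` between characteristic
functions. The link with moments is `mem_complexM2_iff`: a law has finite second moment and mean `γ`
exactly when it is at finite distance from the point mass at `γ`.

Conditioning on the coefficients expresses the new characteristic functions as averages of products
of the old ones at `conj (A i r) * t`. Factors in the unit disc and the weight `‖t‖ ^ 2` give the
Lipschitz constant `∑ r, E ‖A i r‖ ^ 2 < 1`. The mean condition says that the point masses at `γ`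
are moved by a finite distance, so the set of tuples at finite distance from them is invariant.

Uniqueness follows by iterating the contraction. For existence, the characteristic functions of the
iterates converge geometrically, and Lévy's theorem turns the limit into a law; its moment and mean
come from the finite distance, so no completeness of the metric is needed. -/

/-! ### Elementary estimates -/

theorem norm_exp_ofReal_mul_I_sub_one_sub_le (y : ℝ) :
    ‖Complex.exp (y * Complex.I) - 1 - y * Complex.I‖ ≤ 2 * y ^ 2 := by
  rcases le_total |y| 1 with h | h
  · have := Complex.norm_exp_sub_one_sub_id_le (x := y * Complex.I) (by simpa using h)
    simp only [Complex.norm_mul, Complex.norm_real, Real.norm_eq_abs, Complex.norm_I, mul_one,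
      sq_abs] at this
    nlinarith [sq_nonneg y]
  · have h1 : ‖Complex.exp (y * Complex.I) - 1‖ ≤ |y| := by
      simpa [mul_comm] using Real.norm_exp_I_mul_ofReal_sub_one_le (x := y)
    have h2 : ‖(y : ℂ) * Complex.I‖ = |y| := by simp
    have h3 := norm_sub_le (Complex.exp (y * Complex.I) - 1) (y * Complex.I)
    have h4 : |y| ≤ |y| ^ 2 := by nlinarith
    rw [sq_abs] at h4
    linarith

/-- Replace one factor at a time; the remaining factors lie in the unit disc. -/
theorem norm_prod_sub_prod_le_sum_norm_sub {ι : Type*} (s : Finset ι) (a b : ι → ℂ)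
    (ha : ∀ i, ‖a i‖ ≤ 1) (hb : ∀ i, ‖b i‖ ≤ 1) :
    ‖∏ i ∈ s, a i - ∏ i ∈ s, b i‖ ≤ ∑ i ∈ s, ‖a i - b i‖ := by
  classical
  induction s using Finset.induction_on with
  | empty => simp
  | insert j s hj ih =>
    rw [Finset.prod_insert hj, Finset.prod_insert hj, Finset.sum_insert hj]
    have hp : ‖∏ i ∈ s, b i‖ ≤ 1 := by
      rw [norm_prod]
      exact Finset.prod_le_one (fun i _ => norm_nonneg _) fun i _ => hb i
    calc ‖a j * ∏ i ∈ s, a i - b j * ∏ i ∈ s, b i‖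
        = ‖a j * (∏ i ∈ s, a i - ∏ i ∈ s, b i) + (a j - b j) * ∏ i ∈ s, b i‖ := by ring_nf
      _ ≤ ‖a j‖ * ‖∏ i ∈ s, a i - ∏ i ∈ s, b i‖ + ‖a j - b j‖ * ‖∏ i ∈ s, b i‖ := by
        grw [norm_add_le, norm_mul, norm_mul]
      _ ≤ 1 * ‖∏ i ∈ s, a i - ∏ i ∈ s, b i‖ + ‖a j - b j‖ * 1 := by
        gcongr
        exact ha j
      _ ≤ _ := by linarith

/-! ### Second moment and mean in terms of the characteristic function -/

theorem integrable_exp_inner_mul_I (μ : ProbabilityMeasure ℂ) (t : ℂ) :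
    Integrable (fun z : ℂ => Complex.exp (⟪z, t⟫ * Complex.I)) (μ : Measure ℂ) := by
  refine Integrable.of_bound (by fun_prop) 1 (.of_forall fun z => ?_)
  exact (Complex.norm_exp_ofReal_mul_I _).le

/-- A law with finite second moment and mean `γ` has the same characteristic function as the point
mass at `γ` up to an error of second order. -/
theorem exists_norm_charFun_sub_le_of_mem_complexM2 {γ : ℂ} {μ : ProbabilityMeasure ℂ}
    (h : μ ∈ complexM2 γ) :
    ∃ C : ℝ, ∀ t : ℂ, ‖charFun (μ : Measure ℂ) t - Complex.exp (⟪γ, t⟫ * Complex.I)‖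
      ≤ C * ‖t‖ ^ 2 := by
  obtain ⟨h2, hm⟩ := h
  have hi : Integrable (fun z : ℂ => z) (μ : Measure ℂ) := h2.integrable one_le_two
  have hsq : Integrable (fun z : ℂ => ‖z - γ‖ ^ 2) (μ : Measure ℂ) :=
    (h2.sub (memLp_const γ)).integrable_norm_pow two_ne_zero
  refine ⟨2 * ∫ z, ‖z - γ‖ ^ 2 ∂(μ : Measure ℂ), fun t => ?_⟩
  have hi' : Integrable (fun z : ℂ => z - γ) (μ : Measure ℂ) := hi.sub (integrable_const γ)
  have hin : Integrable (fun z : ℂ => ⟪z - γ, t⟫) (μ : Measure ℂ) := hi'.inner_const t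
  have hin0 : ∫ z, ⟪z - γ, t⟫ ∂(μ : Measure ℂ) = 0 := by
    simp_rw [real_inner_comm t]
    rw [integral_inner hi', integral_sub hi (integrable_const γ), hm]
    simp
  have hlin : Integrable (fun z : ℂ => Complex.exp (⟪γ, t⟫ * Complex.I)
      * ((⟪z - γ, t⟫ : ℂ) * Complex.I)) (μ : Measure ℂ) :=
    (hin.ofReal.mul_const _).const_mul _
  have hlin0 : ∫ z, Complex.exp (⟪γ, t⟫ * Complex.I) * ((⟪z - γ, t⟫ : ℂ) * Complex.I)
      ∂(μ : Measure ℂ) = 0 := by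
    rw [integral_const_mul, integral_mul_const, integral_complex_ofReal, hin0]
    simp
  -- The linear term has mean zero, so subtracting it is free and leaves a second-order integrand.
  have key : charFun (μ : Measure ℂ) t - Complex.exp (⟪γ, t⟫ * Complex.I)
      = ∫ z, Complex.exp (⟪γ, t⟫ * Complex.I) * (Complex.exp (⟪z - γ, t⟫ * Complex.I) - 1
          - ⟪z - γ, t⟫ * Complex.I) ∂(μ : Measure ℂ) := by
    have : ∀ z : ℂ, Complex.exp (⟪γ, t⟫ * Complex.I) * (Complex.exp (⟪z - γ, t⟫ * Complex.I) - 1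
          - ⟪z - γ, t⟫ * Complex.I) = Complex.exp (⟪z, t⟫ * Complex.I)
          - Complex.exp (⟪γ, t⟫ * Complex.I)
          - Complex.exp (⟪γ, t⟫ * Complex.I) * (⟪z - γ, t⟫ * Complex.I) := by
      intro z
      rw [mul_sub, mul_sub, ← Complex.exp_add, ← add_mul, ← Complex.ofReal_add, ← inner_add_left,
        add_sub_cancel, mul_one]
    simp_rw [this]
    have hsub : Integrable (fun z : ℂ => Complex.exp (⟪z, t⟫ * Complex.I)
        - Complex.exp (⟪γ, t⟫ * Complex.I)) (μ : Measure ℂ) :=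
      (integrable_exp_inner_mul_I μ t).sub (integrable_const _)
    rw [integral_sub hsub hlin, hlin0,
      integral_sub (integrable_exp_inner_mul_I μ t) (integrable_const _), charFun_apply]
    simp
  rw [key]
  calc _ ≤ ∫ z, 2 * ‖z - γ‖ ^ 2 * ‖t‖ ^ 2 ∂(μ : Measure ℂ) := by
        refine norm_integral_le_of_norm_le ((hsq.const_mul 2).mul_const _) (.of_forall fun z => ?_)
        rw [norm_mul, Complex.norm_exp_ofReal_mul_I, one_mul]
        refine (norm_exp_ofReal_mul_I_sub_one_sub_le _).trans ?_
        rw [mul_assoc, ← mul_pow, ← sq_abs ⟪z - γ, t⟫]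
        gcongr
        exact abs_real_inner_le_norm _ _
    _ = _ := by rw [integral_mul_const, integral_const_mul]

/-- The hypothesis bounds the integral of `1 - cos`. Evaluating at `t / (n + 1)` and multiplying by
`(n + 1) ^ 2` keeps the bound independent of `n`, while the integrands become comparable to the
square; Fatou's lemma concludes. -/
theorem lintegral_sq_inner_lt_top_of_norm_charFun_sub_le {γ : ℂ} {μ : ProbabilityMeasure ℂ} {C : ℝ}
    (h : ∀ t : ℂ, ‖charFun (μ : Measure ℂ) t - Complex.exp (⟪γ, t⟫ * Complex.I)‖ ≤ C * ‖t‖ ^ 2)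
    (t : ℂ) : ∫⁻ z, ENNReal.ofReal (⟪z - γ, t⟫ ^ 2) ∂(μ : Measure ℂ) < ⊤ := by
  have hcos : ∀ t : ℂ, ∫⁻ z, ENNReal.ofReal (1 - Real.cos ⟪z - γ, t⟫) ∂(μ : Measure ℂ)
      ≤ ENNReal.ofReal (C * ‖t‖ ^ 2) := by
    intro t
    have hre : ∀ z : ℂ, 1 - Real.cos ⟪z - γ, t⟫ =
        (1 - Complex.exp (-(⟪γ, t⟫ * Complex.I)) * Complex.exp (⟪z, t⟫ * Complex.I)).re := by
      intro z
      rw [← Complex.exp_add, ← neg_mul, ← add_mul, ← Complex.ofReal_neg, ← Complex.ofReal_add,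
        neg_add_eq_sub, ← inner_sub_left, Complex.sub_re, Complex.exp_ofReal_mul_I_re,
        Complex.one_re]
    have hint : Integrable (fun z : ℂ => 1 - Complex.exp (-(⟪γ, t⟫ * Complex.I))
        * Complex.exp (⟪z, t⟫ * Complex.I)) (μ : Measure ℂ) :=
      (integrable_const _).sub ((integrable_exp_inner_mul_I μ t).const_mul _)
    rw [← ofReal_integral_eq_lintegral_ofReal]
    · refine ENNReal.ofReal_le_ofReal ?_
      simp_rw [hre]
      have h1 : ∫ z, (1 - Complex.exp (-(⟪γ, t⟫ * Complex.I))
          * Complex.exp (⟪z, t⟫ * Complex.I)) ∂(μ : Measure ℂ)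
          = -(Complex.exp (-(⟪γ, t⟫ * Complex.I))
            * (charFun (μ : Measure ℂ) t - Complex.exp (⟪γ, t⟫ * Complex.I))) := by
        rw [integral_sub (integrable_const _) ((integrable_exp_inner_mul_I μ t).const_mul _),
          integral_const_mul, mul_sub, ← Complex.exp_add, charFun_apply]
        simp
      have h2 := integral_re (𝕜 := ℂ) hint
      simp only [RCLike.re_eq_complex_re] at h2
      rw [h2, h1]
      refine (Complex.re_le_norm _).trans ?_
      rw [norm_neg, norm_mul, ← neg_mul, ← Complex.ofReal_neg, Complex.norm_exp_ofReal_mul_I,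
        one_mul]
      exact h t
    · simp_rw [hre]
      exact hint.re
    · exact .of_forall fun z => sub_nonneg.2 (Real.cos_le_one _)
  have hn : ∀ n : ℕ, ∫⁻ z, ENNReal.ofReal (((n : ℝ) + 1) ^ 2
      * (1 - Real.cos (⟪z - γ, t⟫ / ((n : ℝ) + 1)))) ∂(μ : Measure ℂ)
      ≤ ENNReal.ofReal (C * ‖t‖ ^ 2) := by
    intro n
    have hpos : (0 : ℝ) < n + 1 := by positivity
    simp_rw [ENNReal.ofReal_mul (sq_nonneg ((n : ℝ) + 1))]
    rw [lintegral_const_mul _ (by fun_prop)]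
    have := hcos (((n : ℝ) + 1)⁻¹ • t)
    simp_rw [real_inner_smul_right, inv_mul_eq_div] at this
    grw [this, ← ENNReal.ofReal_mul (sq_nonneg _)]
    refine le_of_eq ?_
    congr 1
    rw [norm_smul, Real.norm_of_nonneg (by positivity)]
    field_simp
  -- The constant comes from `cos x ≤ 1 - 2 / π ^ 2 * x ^ 2` for `|x| ≤ π`, which applies once `n ≥
  -- |⟪z - γ, t⟫|`.
  have hlow : ∀ z : ℂ, ENNReal.ofReal (2 / Real.pi ^ 2) * ENNReal.ofReal (⟪z - γ, t⟫ ^ 2)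
      ≤ liminf (fun n : ℕ => ENNReal.ofReal (((n : ℝ) + 1) ^ 2
      * (1 - Real.cos (⟪z - γ, t⟫ / ((n : ℝ) + 1))))) atTop := by
    intro z
    refine le_liminf_of_le (by isBoundedDefault) ?_
    obtain ⟨N, hN⟩ := exists_nat_ge |⟪z - γ, t⟫|
    filter_upwards [eventually_ge_atTop N] with n hnN
    have hpos : (0 : ℝ) < n + 1 := by positivity
    rw [← ENNReal.ofReal_mul (by positivity)]
    refine ENNReal.ofReal_le_ofReal ?_
    have hle : |⟪z - γ, t⟫ / ((n : ℝ) + 1)| ≤ Real.pi := by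
      rw [abs_div, abs_of_pos hpos, div_le_iff₀ hpos]
      have : (N : ℝ) ≤ n := by exact_mod_cast hnN
      nlinarith [Real.pi_gt_three]
    have := Real.cos_le_one_sub_mul_cos_sq hle
    calc 2 / Real.pi ^ 2 * ⟪z - γ, t⟫ ^ 2
        = ((n : ℝ) + 1) ^ 2 * (2 / Real.pi ^ 2 * (⟪z - γ, t⟫ / ((n : ℝ) + 1)) ^ 2) := by
          field_simp
      _ ≤ _ := by
        gcongr
        linarith
  have hfin : ENNReal.ofReal (2 / Real.pi ^ 2)
      * ∫⁻ z, ENNReal.ofReal (⟪z - γ, t⟫ ^ 2) ∂(μ : Measure ℂ) < ⊤ := by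
    rw [← lintegral_const_mul _ (by fun_prop)]
    refine (lintegral_mono hlow).trans_lt ((lintegral_liminf_le (by fun_prop)).trans_lt ?_)
    refine lt_of_le_of_lt ?_ (ENNReal.ofReal_lt_top (r := C * ‖t‖ ^ 2))
    exact (liminf_le_liminf (.of_forall hn)).trans (by simp)
  exact ENNReal.lt_top_of_mul_ne_top_right hfin.ne
    (by have := Real.pi_pos; simp only [ne_eq, ENNReal.ofReal_eq_zero, not_le]; positivity)

/-- The mean of a law is determined by its characteristic function up to second order. -/
theorem eq_of_norm_exp_inner_sub_le {m γ : ℂ} {C : ℝ}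
    (h : ∀ t : ℂ, ‖Complex.exp (⟪m, t⟫ * Complex.I) - Complex.exp (⟪γ, t⟫ * Complex.I)‖
      ≤ C * ‖t‖ ^ 2) : m = γ := by
  rw [← sub_eq_zero, ← norm_eq_zero]
  set w := m - γ with hw
  -- Testing at `t = s • w` makes the difference of exponentials `s * ‖w‖ ^ 2` to first order,
  -- against errors of order `s ^ 2`; then `s → 0`.
  have key : ∀ s : ℝ, 0 < s → ‖w‖ ^ 2 ≤ s * (2 * ‖w‖ ^ 4 + C * ‖w‖ ^ 2) := by
    intro s hs
    have h1 := h (s • w)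
    have h2 : Complex.exp (⟪m, s • w⟫ * Complex.I) = Complex.exp (⟪γ, s • w⟫ * Complex.I)
        * Complex.exp (((s * ‖w‖ ^ 2 : ℝ) : ℂ) * Complex.I) := by
      rw [← Complex.exp_add, ← add_mul, ← Complex.ofReal_add, ← real_inner_self_eq_norm_sq,
        ← real_inner_smul_right, ← inner_add_left, hw, add_sub_cancel]
    rw [h2, ← mul_sub_one, norm_mul, Complex.norm_exp_ofReal_mul_I, one_mul, norm_smul,
      Real.norm_of_nonneg hs.le] at h1
    have h3 := norm_exp_ofReal_mul_I_sub_one_sub_le (s * ‖w‖ ^ 2)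
    have h4 := norm_sub_norm_le (((s * ‖w‖ ^ 2 : ℝ) : ℂ) * Complex.I)
      (Complex.exp (((s * ‖w‖ ^ 2 : ℝ) : ℂ) * Complex.I) - 1)
    rw [norm_sub_rev _ (Complex.exp (((s * ‖w‖ ^ 2 : ℝ) : ℂ) * Complex.I) - 1), norm_mul,
      Complex.norm_I, mul_one, Complex.norm_real, Real.norm_of_nonneg (by positivity)] at h4
    refine le_of_mul_le_mul_left ?_ hs
    calc s * ‖w‖ ^ 2 ≤ 2 * (s * ‖w‖ ^ 2) ^ 2 + C * (s * ‖w‖) ^ 2 := by linarith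
      _ = _ := by ring
  have hlim : Tendsto (fun s : ℝ => s * (2 * ‖w‖ ^ 4 + C * ‖w‖ ^ 2)) (𝓝[>] 0) (𝓝 0) := by
    have : Tendsto (fun s : ℝ => s * (2 * ‖w‖ ^ 4 + C * ‖w‖ ^ 2)) (𝓝 0)
      (𝓝 (0 * (2 * ‖w‖ ^ 4 + C * ‖w‖ ^ 2))) := tendsto_id.mul_const _
    rw [zero_mul] at this
    exact this.mono_left nhdsWithin_le_nhds
  have := ge_of_tendsto hlim (eventually_nhdsWithin_of_forall fun s hs => key s hs)
  exact pow_eq_zero_iff two_ne_zero |>.1 (le_antisymm this (sq_nonneg _))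

/-- For the converse, the directions `1` and `I` control both coordinates, so a mean exists; the
forward direction at that mean, compared with the hypothesis, identifies it with `γ`. -/
theorem mem_complexM2_iff {γ : ℂ} {μ : ProbabilityMeasure ℂ} :
    μ ∈ complexM2 γ ↔ ∃ C : ℝ, ∀ t : ℂ,
      ‖charFun (μ : Measure ℂ) t - Complex.exp (⟪γ, t⟫ * Complex.I)‖ ≤ C * ‖t‖ ^ 2 := by
  refine ⟨exists_norm_charFun_sub_le_of_mem_complexM2, fun ⟨C, h⟩ => ?_⟩
  have hL : MemLp (fun z : ℂ => z) 2 (μ : Measure ℂ) := by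
    have hc : ∀ t : ℂ, MemLp (fun z : ℂ => ⟪z - γ, t⟫) 2 (μ : Measure ℂ) := by
      intro t
      rw [memLp_two_iff_integrable_sq (by fun_prop)]
      refine ⟨by fun_prop, ?_⟩
      rw [hasFiniteIntegral_iff_ofReal (.of_forall fun z => sq_nonneg _)]
      exact lintegral_sq_inner_lt_top_of_norm_charFun_sub_le h t
    have h1 : MemLp (fun z : ℂ => z - γ) 2 (μ : Measure ℂ) := by
      refine MemLp.of_le ((hc 1).norm.add (hc Complex.I).norm) (by fun_prop)
        (.of_forall fun z => ?_)
      have := Complex.norm_le_abs_re_add_abs_im (z - γ)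
      simpa [Complex.inner, abs_of_nonneg, add_nonneg, neg_add_eq_sub] using this
    simpa [Function.comp_def, Pi.add_def] using h1.add (memLp_const γ)
  refine ⟨hL, ?_⟩
  obtain ⟨C', h'⟩ := exists_norm_charFun_sub_le_of_mem_complexM2 ⟨hL, rfl⟩
  refine eq_of_norm_exp_inner_sub_le (C := C' + C) fun t => ?_
  have h1 := h t
  have h2 := h' t
  rw [norm_sub_rev] at h2
  have h3 := norm_sub_le_norm_sub_add_norm_sub
    (Complex.exp (⟪∫ z, z ∂(μ : Measure ℂ), t⟫ * Complex.I)) (charFun (μ : Measure ℂ) t)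
    (Complex.exp (⟪γ, t⟫ * Complex.I))
  linarith


/-! ### The map on characteristic functions -/

/-- Multiplication by `a` has adjoint multiplication by `conj a` for the real inner product on `ℂ`.
-/
theorem inner_affineSum {d' : ℕ} {Ω : Type*} (A : Fin d' → Ω → ℂ) (b : Ω → ℂ)
    (x : Ω × (Fin d' → ℂ)) (t : ℂ) :
    ⟪affineSum A b x, t⟫ = ⟪b x.1, t⟫ + ∑ r, ⟪x.2 r, conj (A r x.1) * t⟫ := by
  rw [affineSum, inner_add_left, sum_inner, add_comm]
  congr 1
  refine Finset.sum_congr rfl fun r _ => ?_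
  simp only [Complex.inner, map_mul]
  ring_nf

section

variable {d d' : ℕ} {Ω : Type*} [MeasurableSpace Ω] (P : Measure Ω) [IsProbabilityMeasure P]
  (A : Fin d → Fin d' → Ω → ℂ) (b : Fin d → Ω → ℂ)
  (hA : ∀ i r, AEMeasurable (A i r) P) (hb : ∀ i, AEMeasurable (b i) P)
  (π : Fin d → Fin d' → Fin d)

/-- Fubini: for fixed `ω`, the integral over the independent coordinates factorises. -/
theorem charFun_fixedPointMap (μ : Fin d → ProbabilityMeasure ℂ) (i : Fin d) (t : ℂ) :
    charFun (fixedPointMap P A b hA hb π μ i : Measure ℂ) t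
      = ∫ ω, Complex.exp (⟪b i ω, t⟫ * Complex.I)
          * ∏ r, charFun (μ (π i r) : Measure ℂ) (conj (A i r ω) * t) ∂P := by
  have hm := affineSum_aemeasurable P (Measure.pi fun r => (μ (π i r) : Measure ℂ)) (A i) (b i)
    (hA i) (hb i)
  have hc : Continuous fun z : ℂ => Complex.exp (⟪z, t⟫ * Complex.I) := by fun_prop
  change charFun ((P.prod (Measure.pi fun r => (μ (π i r) : Measure ℂ))).map
    (affineSum (A i) (b i))) t = _
  rw [charFun_apply, integral_map hm hc.aestronglyMeasurable, integral_prod]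
  · refine integral_congr_ae (.of_forall fun ω => ?_)
    simp only [inner_affineSum, Complex.ofReal_add, Complex.ofReal_sum, add_mul, Finset.sum_mul,
      Complex.exp_add, Complex.exp_sum]
    rw [integral_const_mul]
    congr 1
    exact integral_fintype_prod_eq_prod
      fun r (z : ℂ) => Complex.exp (⟪z, conj (A i r ω) * t⟫ * Complex.I)
  · refine Integrable.of_bound (hc.comp_aestronglyMeasurable hm.aestronglyMeasurable) 1
      (.of_forall fun x => ?_)
    exact (Complex.norm_exp_ofReal_mul_I _).le

/-- In the weighted distance `sup_t ‖φ t - ψ t‖ / ‖t‖ ^ 2` between characteristic functions, the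
map `fixedPointMap` is Lipschitz. -/
theorem norm_charFun_fixedPointMap_sub_le (hA2 : ∀ i r, MemLp (A i r) 2 P) {C : ℝ}
    {μ ν : Fin d → ProbabilityMeasure ℂ}
    (h : ∀ i t, ‖charFun (μ i : Measure ℂ) t - charFun (ν i : Measure ℂ) t‖ ≤ C * ‖t‖ ^ 2)
    (i : Fin d) (t : ℂ) :
    ‖charFun (fixedPointMap P A b hA hb π μ i : Measure ℂ) t
      - charFun (fixedPointMap P A b hA hb π ν i : Measure ℂ) t‖
      ≤ (∑ r, ∫ ω, ‖A i r ω‖ ^ 2 ∂P) * C * ‖t‖ ^ 2 := by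
  have hint : ∀ ρ : Fin d → ProbabilityMeasure ℂ, Integrable (fun ω =>
      Complex.exp (⟪b i ω, t⟫ * Complex.I)
        * ∏ r, charFun (ρ (π i r) : Measure ℂ) (conj (A i r ω) * t)) P := by
    intro ρ
    refine Integrable.of_bound ?_ 1 (.of_forall fun ω => ?_)
    · refine AEMeasurable.aestronglyMeasurable (AEMeasurable.mul ?_ ?_)
      · exact (by fun_prop : Measurable fun z : ℂ => Complex.exp (⟪z, t⟫ * Complex.I)
          ).comp_aemeasurable (hb i)
      · refine Finset.aemeasurable_fun_prod _ fun r _ => ?_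
        exact (by fun_prop : Measurable fun z : ℂ => charFun (ρ (π i r) : Measure ℂ) (conj z * t)
          ).comp_aemeasurable (hA i r)
    · rw [norm_mul, Complex.norm_exp_ofReal_mul_I, one_mul, norm_prod]
      exact Finset.prod_le_one (fun _ _ => norm_nonneg _) fun _ _ => norm_charFun_le_one _
  have hsq : ∀ r, Integrable (fun ω => ‖A i r ω‖ ^ 2) P := fun r =>
    (hA2 i r).integrable_norm_pow two_ne_zero
  rw [charFun_fixedPointMap, charFun_fixedPointMap, ← integral_sub (hint μ) (hint ν)]
  calc _ ≤ ∫ ω, (∑ r, ‖A i r ω‖ ^ 2) * C * ‖t‖ ^ 2 ∂P := by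
        refine norm_integral_le_of_norm_le
          (((integrable_finsetSum _ fun r _ => hsq r).mul_const _).mul_const _)
          (.of_forall fun ω => ?_)
        rw [← mul_sub, norm_mul, Complex.norm_exp_ofReal_mul_I, one_mul]
        refine (norm_prod_sub_prod_le_sum_norm_sub _ _ _ (fun _ => norm_charFun_le_one _)
          fun _ => norm_charFun_le_one _).trans ?_
        rw [Finset.sum_mul, Finset.sum_mul]
        refine Finset.sum_le_sum fun r _ => (h _ _).trans_eq ?_
        rw [norm_mul, RCLike.norm_conj]
        ring
    _ = _ := by
      rw [integral_mul_const, integral_mul_const, integral_finsetSum _ fun r _ => hsq r]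

/-- The tuple of point masses at `γ`. -/
noncomputable def diracTuple (γ : Fin d → ℂ) : Fin d → ProbabilityMeasure ℂ :=
  fun i => ⟨Measure.dirac (γ i), inferInstance⟩

theorem charFun_diracTuple (γ : Fin d → ℂ) (i : Fin d) (t : ℂ) :
    charFun (diracTuple γ i : Measure ℂ) t = Complex.exp (⟪γ i, t⟫ * Complex.I) :=
  charFun_dirac t

/-- With point masses the `Z i r` are constants, so the image is the law of `b i + ∑ r, γ (π i r) *
A i r`, whose mean is given by `hmean`. -/
theorem fixedPointMap_diracTuple_mem (hA2 : ∀ i r, MemLp (A i r) 2 P) (hb2 : ∀ i, MemLp (b i) 2 P)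
    {γ : Fin d → ℂ}
    (hmean : ∀ i, ∫ ω, b i ω ∂P + ∑ r, γ (π i r) * ∫ ω, A i r ω ∂P = γ i) (i : Fin d) :
    fixedPointMap P A b hA hb π (diracTuple γ) i ∈ complexM2 (γ i) := by
  set X : Ω → ℂ := fun ω => b i ω + ∑ r, γ (π i r) * A i r ω with hX
  have hXA : ∀ r, MemLp (fun ω => γ (π i r) * A i r ω) 2 P := fun r => (hA2 i r).const_mul _
  have hX2 : MemLp X 2 P := (hb2 i).add (memLp_finsetSum _ fun r _ => hXA r)
  have hXm : AEMeasurable X P := hX2.aestronglyMeasurable.aemeasurable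
  have hlaw : (fixedPointMap P A b hA hb π (diracTuple γ) i : Measure ℂ) = P.map X := by
    have : IsProbabilityMeasure (P.map X) := Measure.isProbabilityMeasure_map hXm
    refine Measure.ext_of_charFun (funext fun t => ?_)
    rw [charFun_fixedPointMap, charFun_apply, integral_map hXm (by fun_prop)]
    refine integral_congr_ae (.of_forall fun ω => ?_)
    simp only [charFun_diracTuple, hX]
    rw [← Complex.exp_sum, ← Complex.exp_add, ← Finset.sum_mul, ← add_mul, ← Complex.ofReal_sum,
      ← Complex.ofReal_add, inner_add_left, sum_inner]
    congr 4
    refine Finset.sum_congr rfl fun r _ => ?_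
    simp only [Complex.inner, map_mul]
    ring_nf
  refine ⟨?_, ?_⟩
  · rw [hlaw, memLp_map_measure_iff (by fun_prop) hXm]
    exact hX2
  · rw [hlaw, integral_map hXm (by fun_prop), ← hmean i, hX, integral_add
      ((hb2 i).integrable one_le_two)
      (integrable_finsetSum _ fun r _ => (hXA r).integrable one_le_two),
      integral_finsetSum _ fun r _ => (hXA r).integrable one_le_two]
    simp_rw [integral_const_mul]

/-- A single nonnegative constant for all components is what the contraction argument iterates on.
-/
theorem mem_pi_complexM2_iff {γ : Fin d → ℂ} {μ : Fin d → ProbabilityMeasure ℂ} :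
    μ ∈ (Set.univ.pi fun i => complexM2 (γ i)) ↔ ∃ C : ℝ, 0 ≤ C ∧ ∀ i t,
      ‖charFun (μ i : Measure ℂ) t - charFun (diracTuple γ i : Measure ℂ) t‖ ≤ C * ‖t‖ ^ 2 := by
  simp only [Set.mem_univ_pi, mem_complexM2_iff, charFun_diracTuple]
  refine ⟨fun h => ?_, fun ⟨C, _, h⟩ i => ⟨C, h i⟩⟩
  choose C hC using h
  refine ⟨∑ i, |C i|, Finset.sum_nonneg fun i _ => abs_nonneg _, fun i t => (hC i t).trans ?_⟩
  gcongr
  exact (le_abs_self _).trans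
    (Finset.single_le_sum (fun j _ => abs_nonneg (C j)) (Finset.mem_univ i))

/-- Triangle inequality through the image of the point masses. -/
theorem mapsTo_fixedPointMap (hA2 : ∀ i r, MemLp (A i r) 2 P) (hb2 : ∀ i, MemLp (b i) 2 P)
    {γ : Fin d → ℂ}
    (hmean : ∀ i, ∫ ω, b i ω ∂P + ∑ r, γ (π i r) * ∫ ω, A i r ω ∂P = γ i) :
    Set.MapsTo (fixedPointMap P A b hA hb π)
      (Set.univ.pi fun i => complexM2 (γ i)) (Set.univ.pi fun i => complexM2 (γ i)) := by
  intro μ hμ i _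
  obtain ⟨C, -, hC⟩ := mem_pi_complexM2_iff.1 hμ
  obtain ⟨C', hC'⟩ := mem_complexM2_iff.1
    (fixedPointMap_diracTuple_mem P A b hA hb π hA2 hb2 hmean i)
  refine mem_complexM2_iff.2 ⟨(∑ r, ∫ ω, ‖A i r ω‖ ^ 2 ∂P) * C + C', fun t => ?_⟩
  rw [add_mul]
  exact (norm_sub_le_norm_sub_add_norm_sub _ _ _).trans
    (add_le_add (norm_charFun_fixedPointMap_sub_le P A b hA hb π hA2 hC i t) (hC' t))

/-! ### Uniqueness and existence of the fixed point -/

theorem ProbabilityMeasure.ext_of_charFun {μ ν : ProbabilityMeasure ℂ}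
    (h : ∀ t, charFun (μ : Measure ℂ) t = charFun (ν : Measure ℂ) t) : μ = ν :=
  Subtype.ext (Measure.ext_of_charFun (μ := (μ : Measure ℂ)) (ν := (ν : Measure ℂ)) (funext h))

/-- **Lévy's continuity theorem**: a pointwise limit of characteristic functions that is continuous
at `0` is a characteristic function. -/
theorem exists_charFun_eq_of_tendsto {E : Type*} [NormedAddCommGroup E] [InnerProductSpace ℝ E]
    [FiniteDimensional ℝ E] [MeasurableSpace E] [BorelSpace E] {μ : ℕ → ProbabilityMeasure E}
    {f : E → ℂ} (hf : ContinuousAt f 0)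
    (h : ∀ t, Tendsto (fun n => charFun (μ n : Measure E) t) atTop (𝓝 (f t))) :
    ∃ ν : ProbabilityMeasure E, ∀ t, charFun (ν : Measure E) t = f t := by
  have htight : IsTightMeasureSet {((ρ : ProbabilityMeasure E) : Measure E) | ρ ∈ Set.range μ} := by
    have := isTightMeasureSet_of_tendsto_charFun (μ := fun n => (μ n : Measure E)) hf h
    convert! this using 1
    ext ρ
    simp
  -- Tightness gives a weak limit along a nonprincipal ultrafilter, which replaces the choice of a
  -- subsequence.
  obtain ⟨ν, -, hν : Tendsto _ _ _⟩ :=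
    (isCompact_closure_of_isTightMeasureSet htight).ultrafilter_le_nhds
      ((hyperfilter ℕ).map μ) (.trans (by simp) (monotone_principal subset_closure))
  refine ⟨ν, fun t => tendsto_nhds_unique ?_ ((h t).mono_left Nat.hyperfilter_le_atTop)⟩
  rw [ProbabilityMeasure.tendsto_iff_forall_integral_rclike_tendsto ℂ] at hν
  simp_rw [charFun_eq_integral_innerProbChar]
  exact hν (BoundedContinuousFunction.innerProbChar t)

theorem eq_of_isFixedPt_fixedPointMap (hA2 : ∀ i r, MemLp (A i r) 2 P) {ξ : ℝ} (hξ0 : 0 ≤ ξ)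
    (hξ1 : ξ < 1) (hξ : ∀ i, ∑ r, ∫ ω, ‖A i r ω‖ ^ 2 ∂P ≤ ξ) {γ : Fin d → ℂ}
    {μ ν : Fin d → ProbabilityMeasure ℂ}
    (hμ : μ ∈ (Set.univ.pi fun i => complexM2 (γ i)))
    (hν : ν ∈ (Set.univ.pi fun i => complexM2 (γ i)))
    (hμf : Function.IsFixedPt (fixedPointMap P A b hA hb π) μ)
    (hνf : Function.IsFixedPt (fixedPointMap P A b hA hb π) ν) : μ = ν := by
  obtain ⟨C, hC0, hC⟩ := mem_pi_complexM2_iff.1 hμ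
  obtain ⟨D, hD0, hD⟩ := mem_pi_complexM2_iff.1 hν
  have key : ∀ n : ℕ, ∀ i t, ‖charFun (μ i : Measure ℂ) t - charFun (ν i : Measure ℂ) t‖
      ≤ ξ ^ n * (C + D) * ‖t‖ ^ 2 := by
    intro n
    induction n with
    | zero =>
      intro i t
      have h1 := hC i t
      have h2 := hD i t
      rw [norm_sub_rev] at h2
      have := norm_sub_le_norm_sub_add_norm_sub (charFun (μ i : Measure ℂ) t)
        (charFun (diracTuple γ i : Measure ℂ) t) (charFun (ν i : Measure ℂ) t)
      rw [pow_zero]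
      linarith
    | succ n ih =>
      intro i t
      have := norm_charFun_fixedPointMap_sub_le P A b hA hb π hA2 ih i t
      rw [hμf, hνf] at this
      refine this.trans ?_
      rw [pow_succ' ξ, mul_assoc ξ]
      gcongr
      exact hξ i
  refine funext fun i => ProbabilityMeasure.ext_of_charFun fun t => ?_
  rw [← sub_eq_zero, ← norm_le_zero_iff]
  have hlim : Tendsto (fun n : ℕ => ξ ^ n * (C + D) * ‖t‖ ^ 2) atTop (𝓝 0) := by
    simpa using ((tendsto_pow_atTop_nhds_zero_of_lt_one hξ0 hξ1).mul_const (C + D)).mul_const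
      (‖t‖ ^ 2)
  exact ge_of_tendsto' hlim fun n => key n i t

/-- Picard iteration started at the point masses. Summing the geometric steps gives the constant `C
/ (1 - ξ)`; at `n = 0` this bound puts the limit in the invariant set. -/
theorem exists_isFixedPt_fixedPointMap (hA2 : ∀ i r, MemLp (A i r) 2 P)
    (hb2 : ∀ i, MemLp (b i) 2 P) {ξ : ℝ} (hξ0 : 0 ≤ ξ)
    (hξ1 : ξ < 1) (hξ : ∀ i, ∑ r, ∫ ω, ‖A i r ω‖ ^ 2 ∂P ≤ ξ) {γ : Fin d → ℂ}
    (hmean : ∀ i, ∫ ω, b i ω ∂P + ∑ r, γ (π i r) * ∫ ω, A i r ω ∂P = γ i) :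
    ∃ μ ∈ (Set.univ.pi fun i => complexM2 (γ i)),
      Function.IsFixedPt (fixedPointMap P A b hA hb π) μ := by
  set T := fixedPointMap P A b hA hb π with hT
  obtain ⟨C, hC0, hC⟩ := mem_pi_complexM2_iff.1
    (fun i _ => fixedPointMap_diracTuple_mem P A b hA hb π hA2 hb2 hmean i :
      T (diracTuple γ) ∈ (Set.univ.pi fun i => complexM2 (γ i)))
  set φ : ℕ → Fin d → ℂ → ℂ := fun n i t => charFun (T^[n] (diracTuple γ) i : Measure ℂ) t with hφ
  have hstep : ∀ n : ℕ, ∀ i t, ‖φ (n + 1) i t - φ n i t‖ ≤ ξ ^ n * C * ‖t‖ ^ 2 := by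
    intro n
    induction n with
    | zero => simpa [hφ] using hC
    | succ n ih =>
      intro i t
      have := norm_charFun_fixedPointMap_sub_le P A b hA hb π hA2 ih i t
      rw [← hT, ← Function.iterate_succ_apply' T, ← Function.iterate_succ_apply' T] at this
      refine this.trans ?_
      rw [pow_succ' ξ, mul_assoc ξ]
      gcongr
      exact hξ i
  have hdist : ∀ i t n, dist (φ n i t) (φ (n + 1) i t) ≤ C * ‖t‖ ^ 2 * ξ ^ n := by
    intro i t n
    rw [dist_comm, dist_eq_norm]
    exact (hstep n i t).trans_eq (by ring)
  have hlim : ∀ i t, ∃ z, Tendsto (fun n => φ n i t) atTop (𝓝 z) := fun i t =>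
    cauchySeq_tendsto_of_complete (cauchySeq_of_le_geometric ξ _ hξ1 (hdist i t))
  choose f hf using hlim
  have hbound : ∀ n i t, ‖φ n i t - f i t‖ ≤ ξ ^ n * (C / (1 - ξ)) * ‖t‖ ^ 2 := by
    intro n i t
    rw [← dist_eq_norm]
    exact (dist_le_of_le_geometric_of_tendsto ξ _ hξ1 (hdist i t) (hf i t) n).trans_eq (by ring)
  -- Near `0` the limit differs from the continuous `φ 0 i` by `O(‖t‖ ^ 2)`.
  have hcont : ∀ i, ContinuousAt (f i) 0 := by
    intro i
    have h1 : Tendsto (fun t => φ 0 i t) (𝓝 0) (𝓝 (φ 0 i 0)) :=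
      (continuous_charFun (μ := (T^[0] (diracTuple γ) i : Measure ℂ))).continuousAt
    have h2 : Tendsto (fun t => φ 0 i t - f i t) (𝓝 0) (𝓝 0) := by
      refine squeeze_zero_norm (hbound 0 i) ?_
      have : Continuous fun t : ℂ => ξ ^ 0 * (C / (1 - ξ)) * ‖t‖ ^ 2 := by fun_prop
      simpa using this.tendsto 0
    have h3 : f i 0 = φ 0 i 0 := by
      have := hbound 0 i 0
      rw [norm_zero, zero_pow two_ne_zero, mul_zero, norm_le_zero_iff, sub_eq_zero] at this
      exact this.symm
    rw [ContinuousAt, h3]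
    simpa using h1.sub h2
  have hex : ∀ i, ∃ ν : ProbabilityMeasure ℂ, ∀ t, charFun (ν : Measure ℂ) t = f i t := fun i =>
    exists_charFun_eq_of_tendsto (μ := fun n => T^[n] (diracTuple γ) i) (hcont i) (hf i)
  choose μ hμ using hex
  refine ⟨μ, mem_pi_complexM2_iff.2 ⟨C / (1 - ξ), div_nonneg hC0 (sub_nonneg.2 hξ1.le),
    fun i t => ?_⟩, funext fun i => ProbabilityMeasure.ext_of_charFun fun t => ?_⟩
  · have := hbound 0 i t
    rw [norm_sub_rev, pow_zero, one_mul, ← hμ] at this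
    exact this
  · rw [hμ]
    -- Both sides are limits of `φ (n + 1) i t`: the contraction estimate also applies between the
    -- `n`-th iterate and `μ`.
    refine tendsto_nhds_unique ?_ ((tendsto_add_atTop_iff_nat 1).2 (hf i t))
    rw [tendsto_iff_norm_sub_tendsto_zero]
    refine squeeze_zero (g := fun n : ℕ => (∑ r, ∫ ω, ‖A i r ω‖ ^ 2 ∂P)
      * (ξ ^ n * (C / (1 - ξ))) * ‖t‖ ^ 2) (fun _ => norm_nonneg _) (fun n => ?_) ?_
    · have := norm_charFun_fixedPointMap_sub_le P A b hA hb π hA2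
        (μ := T^[n] (diracTuple γ)) (ν := μ) (fun i t => (hμ i t).symm ▸ hbound n i t) i t
      rw [← hT, ← Function.iterate_succ_apply' T] at this
      exact this
    · simpa using (((tendsto_pow_atTop_nhds_zero_of_lt_one hξ0 hξ1).mul_const
        (C / (1 - ξ))).const_mul (∑ r, ∫ ω, ‖A i r ω‖ ^ 2 ∂P)).mul_const (‖t‖ ^ 2)

end

theorem mainTheorem3 {d d' : ℕ} {Ω : Type*} [MeasurableSpace Ω]
    (P : Measure Ω) [IsProbabilityMeasure P]
    (A : Fin d → Fin d' → Ω → ℂ) (b : Fin d → Ω → ℂ)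
    (hA : ∀ i r, AEMeasurable (A i r) P) (hb : ∀ i, AEMeasurable (b i) P)
    (π : Fin d → Fin d' → Fin d) (γ : Fin d → ℂ)
    (hA2 : ∀ i r, MemLp (A i r) 2 P) (hb2 : ∀ i, MemLp (b i) 2 P)
    (hmean : ∀ i, ∫ ω, b i ω ∂P + ∑ r, γ (π i r) * ∫ ω, A i r ω ∂P = γ i)
    (hcontr : ∀ i, ∑ r, ∫ ω, ‖A i r ω‖ ^ 2 ∂P < 1) :
    Set.MapsTo (fixedPointMap P A b hA hb π)
        (Set.univ.pi fun i => complexM2 (γ i)) (Set.univ.pi fun i => complexM2 (γ i)) ∧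
      ∃! μ : Fin d → ProbabilityMeasure ℂ,
        μ ∈ (Set.univ.pi fun i => complexM2 (γ i)) ∧
          Function.IsFixedPt (fixedPointMap P A b hA hb π) μ := by
  refine ⟨mapsTo_fixedPointMap P A b hA hb π hA2 hb2 hmean, ?_⟩
  obtain ⟨ξ, hξ0, hξ1, hξ⟩ : ∃ ξ : ℝ, 0 ≤ ξ ∧ ξ < 1 ∧
      ∀ i, ∑ r, ∫ ω, ‖A i r ω‖ ^ 2 ∂P ≤ ξ := by
    have hnn : ∀ i, 0 ≤ ∑ r, ∫ ω, ‖A i r ω‖ ^ 2 ∂P := fun i =>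
      Finset.sum_nonneg fun r _ => integral_nonneg fun ω => sq_nonneg _
    -- For `d = 0` there is no maximal row sum, and any `ξ` in `[0, 1)` serves.
    rcases isEmpty_or_nonempty (Fin d) with hd | hd
    · exact ⟨0, le_rfl, one_pos, fun i => hd.elim i⟩
    · obtain ⟨j, hj⟩ := Finite.exists_max fun i => ∑ r, ∫ ω, ‖A i r ω‖ ^ 2 ∂P
      exact ⟨_, hnn j, hcontr j, hj⟩
  obtain ⟨μ, hμ, hμf⟩ :=
    exists_isFixedPt_fixedPointMap P A b hA hb π hA2 hb2 hξ0 hξ1 hξ hmean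
  exact ⟨μ, ⟨hμ, hμf⟩, fun ν ⟨hν, hνf⟩ =>
    eq_of_isFixedPt_fixedPointMap P A b hA hb π hA2 hξ0 hξ1 hξ hν hμ hνf hμf⟩
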